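/- Let $N\ge 1$, $K,M\ge 0$ be integers and $\mathcal M=\{0,1,\dots,M\}$. Consider a time-slotted system of $N$ queues and $K$ servers. $\mathcal S=\mathcal M^{N\times K}$ is the set of channel states $C_s$, and $\mathcal I$ is the set of allocation matrices, i.e. the $0/1$ matrices of size $N\times K$ with at most one $1$ in each column; $\circledast$ is the entrywise product. In slot $t\ge1$ the channel state is $C(t)\in\mathcal S$, the allocation is $I(t)\in\mathcal I$, the arrivals are $A(t)\in\mathbb Z_{\ge0}^N$, and the queue lengths $X(t)\in\mathbb Z_{\ge0}^N$ evolve by $$X_n(t)=\Big(X_n(t-1)-\sum_{k=1}^K C_{n,k}(t)I_{n,k}(t)\Big)^+ +A_n(t),$$ where $E[X_n(0)]<\infty$ for every $n$. Assume that $\Pr(C(t)=C_s)=\pi_s$ for all $t\ge 1$ and $s\in\mathcal S$, that $E[A_n(t)^2]\le A_{max}^2<\infty$ for all $n$ and $t\ge 1$, and that for each $t\ge1$ both $A(t)$ and $C(t)$ are (each separately) independent of $(X(0),\dots,X(t-1))$. The Maximum Weight (MW) policy chooses in each slot some $I(t)$ that maximizes $\sum_n X_n(t-1)\sum_k C_{n,k}(t)I_{n,k}$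 over $I\in\mathcal I$, with ties broken arbitrarily. Let $\mathcal P\subset\mathbb R^N$ be the convex hull of the vectors $\sum_{s}\pi_s (C_s\circledast I_s)\underline 1_K^{\mathrm T}$ over all maps $s\mapsto I_s$ from $\mathcal S$ to $\mathcal I$. Let $V$ be the set of $\alpha\in\mathbb R_{\ge0}^N$ such that for every $\mathcal U\subset\{1,\dots,N\}$ for which $\alpha$ is not identically zero on $\mathcal U$ nor on its complement, there are $i\in\mathcal U$, $j\notin\mathcal U$ with $\alpha_i,\alpha_j\ne0$ and nonzero $m,n\in\mathcal M$ with $\alpha_i m=\alpha_j n$. Let $\mathcal W$ be the set of all products of $N-1$ elements of $\mathcal M$, and let $\widehat V\subseteq V\cap\mathcal W^N\setminus\{0\}$ be any set such that every nonzero vector of $V$ is a positive multiple of an element of $\widehat V$. Theorem. Suppose that the system is operated under the MW policy and that $$\alpha E[A(t)]^{\mathrm T}<\sum_{s\in\mathcal S}\pi_s\max_{I\in\mathcal I}\big(\alpha(C_s\circledast I)\underline 1_K^{\mathrm T}\big),\qquad \alpha\in\widehat V,$$ for all $t\ge 1$, uniformly in $t$, i.e. for each $\alpha\in\widehat V$ the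 supremum over $t\ge 1$ of the left-hand side is smaller than the right-hand side. Then the system is strongly stable, i.e. $\limsup_{t\to\infty}\frac1t\sum_{\tau=0}^{t-1}E[X_n(\tau)]<\infty$ for every $n$. Moreover, there is a largest $\delta>0$ such that $E[A(t)]+\delta\underline 1_N\in\mathcal P$ for all $t\ge 1$, and with this $\delta$ $$\limsup_{t\to\infty}\frac1t\sum_{\tau=0}^{t-1}\sum_{n=1}^N E[X_n(\tau)]\le\frac{NA_{max}^2+(MK)^2}{2\delta}.$$ -/

import Mathlib

open MeasureTheory ProbabilityTheory Filter
open scoped ENNReal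

noncomputable section

namespace MQMS

/-- Channel states: `N × K` matrices with entries in `{0, 1, ..., M}`. -/
abbrev ChannelState (N K M : ℕ) : Type := Fin N → Fin K → Fin (M + 1)

/-- Allocation matrices: `N × K` matrices with entries in `{0, 1}` in which every column has at
most one `1` (each server serves at most one queue). -/
abbrev Allocation (N K : ℕ) : Type :=
  {I : Fin N → Fin K → Fin 2 // ∀ k, ∑ n, (I n k : ℕ) ≤ 1}

/-- The service offered to queue `n` in channel state `c` under allocation `I`, that is, the
`n`-th entry of `(c ⊛ I) 1ᵀ`, where `⊛` is the entrywise product. -/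
def service {N K M : ℕ} (c : ChannelState N K M) (I : Allocation N K) (n : Fin N) : ℕ :=
  ∑ k, (c n k : ℕ) * (I.1 n k : ℕ)

/-- The weight `α (c ⊛ I) 1ᵀ`. -/
def weight {N K M : ℕ} (α : Fin N → ℝ) (c : ChannelState N K M) (I : Allocation N K) : ℝ :=
  ∑ n, α n * (service c I n : ℝ)

/-- `∑ₛ πₛ max_I α (Cₛ ⊛ I) 1ᵀ`. The supremum is over a finite nonempty type, hence a maximum. -/
def maxMeanWeight {N K M : ℕ} (p : ChannelState N K M → ℝ) (α : Fin N → ℝ) : ℝ :=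
  ∑ s, p s * ⨆ I : Allocation N K, weight α s I

/-- The mean transmission rate vector of a deterministic policy `g`, which allocates the servers
according to the channel state only. -/
def policyRate {N K M : ℕ} (p : ChannelState N K M → ℝ)
    (g : ChannelState N K M → Allocation N K) : Fin N → ℝ :=
  fun n => ∑ s, p s * (service s (g s) n : ℝ)

/-- The polytope of achievable transmission rate vectors. -/
def ratePolytope {N K M : ℕ} (p : ChannelState N K M → ℝ) : Set (Fin N → ℝ) :=
  convexHull ℝ (Set.range (policyRate (N := N) (K := K) (M := M) p))

/-- The set `V` of nonnegative vectors `α` such that, for every splitting of the index set into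
`U` and its complement with `α` nonzero on both parts, there are nonzero entries `α i`, `i ∈ U`,
and `α j`, `j ∉ U`, whose ratio is a ratio of two elements of `{1, ..., M}`. -/
def V (N M : ℕ) : Set (Fin N → ℝ) :=
  {α | (∀ i, 0 ≤ α i) ∧
    ∀ U : Set (Fin N), (∃ i ∈ U, α i ≠ 0) → (∃ j ∈ Uᶜ, α j ≠ 0) →
      ∃ i ∈ U, ∃ j ∈ Uᶜ, ∃ m n : ℕ, m ≤ M ∧ n ≤ M ∧ α i ≠ 0 ∧ α j ≠ 0 ∧ m ≠ 0 ∧ n ≠ 0 ∧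
        α i * m = α j * n}

/-- The set `W` of products of `N - 1` elements of `{0, 1, ..., M}`. -/
def W (N M : ℕ) : Set ℕ :=
  {z | ∃ m : Fin (N - 1) → ℕ, (∀ j, m j ≤ M) ∧ z = ∏ j, m j}

/-- `S` can serve as the set `V̂`: it consists of nonzero vectors of `V` with entries in `W`, and
every nonzero vector of `V` is a positive multiple of a vector of `S`. Neither the scaling of the
representatives nor their uniqueness matters, since the inequalities indexed by `V̂` are
homogeneous. -/
structure IsVHat (N M : ℕ) (S : Set (Fin N → ℝ)) : Prop where
  subset_V : S ⊆ V N M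
  ne_zero : ∀ β ∈ S, β ≠ 0
  entries : ∀ β ∈ S, ∀ n, ∃ z ∈ W N M, β n = (z : ℝ)
  cover : ∀ α ∈ V N M, α ≠ 0 → ∃ β ∈ S, ∃ q : ℝ, 0 < q ∧ α = q • β

variable {Ω : Type*} [MeasurableSpace Ω]

/-- The vector `E[A(t)]`. -/
def meanArrival {N : ℕ} (μ : Measure Ω) (A : ℕ → Ω → Fin N → ℕ) (t : ℕ) : Fin N → ℝ :=
  fun n => ∫ ω, (A t ω n : ℝ) ∂μ

/-- A multi-queue multi-server system with `N` queues, `K` servers and link capacities at most `M`.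
Here `X t` is the vector of queue lengths at the end of slot `t` (`X 0` is the initial one), and
`A t`, `C t`, `I t` for `t ≥ 1` are the arrivals, the channel state and the server allocation in
slot `t`; their values at `t = 0` play no role. -/
structure IsSystem {N K M : ℕ} (μ : Measure Ω) (p : ChannelState N K M → ℝ) (Amax : ℝ)
    (A : ℕ → Ω → Fin N → ℕ) (C : ℕ → Ω → ChannelState N K M)
    (I : ℕ → Ω → Allocation N K) (X : ℕ → Ω → Fin N → ℕ) : Prop where
  measurable_A : ∀ t, Measurable (A (t + 1))
  measurable_C : ∀ t, Measurable (C (t + 1))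
  measurable_I : ∀ t, Measurable (I (t + 1))
  measurable_X : Measurable (X 0)
  /-- The initial queue lengths have finite mean. -/
  initial : ∀ n, ∫⁻ ω, (X 0 ω n : ℝ≥0∞) ∂μ < ⊤
  /-- The channel state has the same distribution `p` in every slot. -/
  channel_law : ∀ t s, μ {ω | C (t + 1) ω = s} = ENNReal.ofReal (p s)
  /-- `p` is a vector of probabilities. -/
  p_nonneg : ∀ s, 0 ≤ p s
  /-- The arrivals have uniformly bounded second moments. -/
  arrival_sq : ∀ t n, ∫⁻ ω, (A (t + 1) ω n : ℝ≥0∞) ^ 2 ∂μ ≤ ENNReal.ofReal (Amax ^ 2)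
  /-- The arrivals of a slot are independent of the queue lengths before it. -/
  indep_arrival : ∀ t, IndepFun (A (t + 1)) (fun ω (τ : Fin (t + 1)) => X τ ω) μ
  /-- The channel state of a slot is independent of the queue lengths before it. -/
  indep_channel : ∀ t, IndepFun (C (t + 1)) (fun ω (τ : Fin (t + 1)) => X τ ω) μ
  /-- Departures first, then arrivals: `X(t+1) = (X(t) - (C(t+1) ⊛ I(t+1)) 1ᵀ)⁺ + A(t+1)`. The
  subtraction of natural numbers is truncated at `0`, which is the positive part. -/
  evolution : ∀ t ω n,
    X (t + 1) ω n = (X t ω n - service (C (t + 1) ω) (I (t + 1) ω) n) + A (t + 1) ω n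

/-- The Maximum Weight policy: in every slot the allocation maximizes the weight
`X(t) (C(t+1) ⊛ I) 1ᵀ`, with ties broken in any way. -/
def IsMaxWeight {N K M : ℕ} (C : ℕ → Ω → ChannelState N K M)
    (I : ℕ → Ω → Allocation N K) (X : ℕ → Ω → Fin N → ℕ) : Prop :=
  ∀ t ω, ∀ J : Allocation N K,
    weight (fun n => (X t ω n : ℝ)) (C (t + 1) ω) J ≤
      weight (fun n => (X t ω n : ℝ)) (C (t + 1) ω) (I (t + 1) ω)

/-- Strong stability of a single queue with queue length process `Y`:
`limsup (1/t) ∑_{τ < t} E[Y(τ)] < ∞`. -/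
def QueueStronglyStable (μ : Measure Ω) (Y : ℕ → Ω → ℕ) : Prop :=
  limsup (fun t : ℕ => (t : ℝ≥0∞)⁻¹ * ∑ τ ∈ Finset.range t, ∫⁻ ω, (Y τ ω : ℝ≥0∞) ∂μ) atTop < ⊤

/-- A network is strongly stable if all its queues are. -/
def StronglyStable {N : ℕ} (μ : Measure Ω) (X : ℕ → Ω → Fin N → ℕ) : Prop :=
  ∀ n, QueueStronglyStable μ (fun t ω => X t ω n)

/-- `limsup (1/t) ∑_{τ < t} ∑ₙ E[Xₙ(τ)]`. -/
def averageBacklog {N : ℕ} (μ : Measure Ω) (X : ℕ → Ω → Fin N → ℕ) : ℝ≥0∞ :=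
  limsup (fun t : ℕ => (t : ℝ≥0∞)⁻¹ *
    ∑ τ ∈ Finset.range t, ∑ n, ∫⁻ ω, (X τ ω n : ℝ≥0∞) ∂μ) atTop

end MQMS

end

/-!
The proof has a polyhedral and a probabilistic half.

*The slack.* A nonnegative vector `y` lies in the rate polytope as soon as `α y ≤ h α` for all
`α ≥ 0`, where `h α = ∑ₛ πₛ max_I α (Cₛ ⊛ I) 1ᵀ` is the support function there
(`mem_ratePolytope_of_le`, a separation argument). It suffices to know this for `α ∈ V`
(`sum_mul_le_maxMeanWeight_of_V`): the maximum splits over the servers, so `h` changes its slope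
only at ties `α i * m = α j * n`. If `α ∉ V`, the support of `α` splits into two parts with no tie
between them, so scaling the two parts by different factors near `1` moves `α` along a line on
which `h` is affine. Hence, among the minimizers of `h α - α y` on the simplex, one of largest
Euclidean norm, not being a midpoint of two other minimizers, belongs to `V`. As `V̂` is finite and
represents the rays of `V`, the strict inequalities leave a common slack `d > 0` with
`E[A(t)] + d 1` in the polytope for all `t`
(`exists_pos_forall_add_mem_ratePolytope`), and a largest slack exists by compactness.

*The drift.* Let `δ` be a slack. In each slot Maximum Weight does at least as well as any policy
based on the channel state alone, hence at least as well as the rate vector `E[A(t)] + δ 1`, and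
the Lyapunov function `∑ n, X n ^ 2` satisfies
`E[L(t+1)] + 2 δ ∑ n, E[X n] ≤ E[L(t)] + N Amax² + (M K)²` (`IsSystem.lyapunov_drift`). Only the
first moment of `X 0` is finite, so `E[L(0)]` may be infinite. The estimate is therefore restricted
to the event that the initial backlog `Y` is at most `t`, where it costs `E[Y²; Y ≤ t] / t`, and on
the complementary event the backlog before time `t` is at most of the order of `Y + t ≤ 2 Y` in
mean (`IsSystem.timeAverage_backlog_le`). Both error terms tend to `0` by dominated convergence,
with dominating function a multiple of `Y`.

Expectations are lower Lebesgue integrals with values in `ℝ≥0∞`, so the drift inequalities are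
written without subtraction and need no integrability of the Lyapunov function.
-/

namespace MQMS

open Topology

variable {N K M : ℕ}

/-! ### Allocations of maximal weight -/

/-- The allocation in which server `k` serves queue `q k`. -/
def serveQueue (q : Fin K → Fin N) : Allocation N K :=
  ⟨fun n k => if n = q k then 1 else 0, fun k => by
    simp [apply_ite (fun x : Fin 2 => (x : ℕ))]⟩

/-- The allocation `I` with the servers of all queues outside `P` switched off. -/
def Allocation.mask (I : Allocation N K) (P : Fin N → Prop) [DecidablePred P] :
    Allocation N K :=
  ⟨fun n k => if P n then I.1 n k else 0, fun k =>
    le_trans (Finset.sum_le_sum fun n _ => by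
      by_cases h : P n <;> simp [h]) (I.2 k)⟩

instance : Nonempty (Allocation N K) := ⟨⟨fun _ _ => 0, by simp⟩⟩

lemma weight_eq_sum_columns (α : Fin N → ℝ) (c : ChannelState N K M) (I : Allocation N K) :
    weight α c I = ∑ k, ∑ n, α n * (c n k : ℕ) * (I.1 n k : ℕ) := by
  rw [Finset.sum_comm]
  simp only [weight, service, Nat.cast_sum, Nat.cast_mul, Finset.mul_sum, mul_assoc]

lemma weight_serveQueue (α : Fin N → ℝ) (c : ChannelState N K M) (q : Fin K → Fin N) :
    weight α c (serveQueue q) = ∑ k, α (q k) * (c (q k) k : ℕ) := by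
  rw [weight_eq_sum_columns]
  refine Finset.sum_congr rfl fun k _ => ?_
  rw [Finset.sum_eq_single (q k)]
  · simp [serveQueue]
  · intro n _ hn
    simp [serveQueue, hn]
  · simp

/-- Serving in every column a queue of largest weight is optimal. -/
lemma weight_le_weight_serveQueue {α : Fin N → ℝ} (hα : ∀ n, 0 ≤ α n) (c : ChannelState N K M)
    (q : Fin K → Fin N) (hq : ∀ k n, α n * (c n k : ℕ) ≤ α (q k) * (c (q k) k : ℕ))
    (J : Allocation N K) : weight α c J ≤ weight α c (serveQueue q) := by
  rw [weight_serveQueue, weight_eq_sum_columns]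
  refine Finset.sum_le_sum fun k _ => ?_
  calc ∑ n, α n * (c n k : ℕ) * (J.1 n k : ℕ)
      ≤ ∑ n, α (q k) * (c (q k) k : ℕ) * (J.1 n k : ℕ) :=
        Finset.sum_le_sum fun n _ => mul_le_mul_of_nonneg_right (hq k n) (Nat.cast_nonneg _)
    _ = α (q k) * (c (q k) k : ℕ) * ((∑ n, (J.1 n k : ℕ) : ℕ) : ℝ) := by
        rw [Nat.cast_sum, Finset.mul_sum]
    _ ≤ α (q k) * (c (q k) k : ℕ) * 1 := by
        refine mul_le_mul_of_nonneg_left ?_ (mul_nonneg (hα _) (Nat.cast_nonneg _))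
        exact_mod_cast J.2 k
    _ = _ := mul_one _

lemma weight_le_iSup (α : Fin N → ℝ) (c : ChannelState N K M) (J : Allocation N K) :
    weight α c J ≤ ⨆ I : Allocation N K, weight α c I :=
  le_ciSup (Set.finite_range _).bddAbove J

lemma maxMeanWeight_smul (p : ChannelState N K M → ℝ) {q : ℝ} (hq : 0 ≤ q) (α : Fin N → ℝ) :
    maxMeanWeight p (q • α) = q * maxMeanWeight p α := by
  unfold maxMeanWeight
  rw [Finset.mul_sum]
  refine Finset.sum_congr rfl fun s _ => ?_
  have : ∀ I : Allocation N K, weight (q • α) s I = q * weight α s I := fun I => by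
    simp only [weight, Finset.mul_sum, Pi.smul_apply, smul_eq_mul, mul_assoc]
  simp_rw [this]
  rw [← Real.mul_iSup_of_nonneg hq]
  ring

lemma continuous_maxMeanWeight (p : ChannelState N K M → ℝ) : Continuous (maxMeanWeight p) := by
  unfold maxMeanWeight
  refine continuous_finsetSum _ fun s _ => continuous_const.mul ?_
  simp_rw [← Finset.sup'_univ_eq_ciSup]
  refine Continuous.finset_sup'_apply _ fun I _ => ?_
  unfold weight
  fun_prop

/-! ### Reduction of the linear inequalities to `V` -/

/-- If `α ∉ V`, so that some `U` splits the support of `α` without a tie `α i * m = α j * n`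
across the splitting, then scaling the coordinates in `U` and those outside `U` by different factors
near `1` does not change which allocations are optimal: for each channel state one and the same
allocation remains optimal. -/
lemma eventually_exists_common_optimum [Nonempty (Fin N)] {α : Fin N → ℝ} (hα : ∀ n, 0 ≤ α n)
    {U : Set (Fin N)}
    (hU : ∀ i ∈ U, ∀ j ∈ Uᶜ, ∀ m n : ℕ, m ≤ M → n ≤ M → α i ≠ 0 → α j ≠ 0 → m ≠ 0 → n ≠ 0 →
      α i * m ≠ α j * n)
    {w : Fin N → ℝ} (hw : ∀ i j, (i ∈ U ↔ j ∈ U) → w i = w j) (c : ChannelState N K M) :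
    ∃ I : Allocation N K, ∀ᶠ ε in 𝓝 (0 : ℝ), ∀ J : Allocation N K,
      weight (fun n => α n * (1 + ε * w n)) c J ≤ weight (fun n => α n * (1 + ε * w n)) c I := by
  have hmax : ∀ k, ∃ n₀, ∀ n, α n * (c n k : ℕ) ≤ α n₀ * (c n₀ k : ℕ) := fun k =>
    Finite.exists_max fun n => α n * ((c n k : ℕ) : ℝ)
  choose q hq using hmax
  refine ⟨serveQueue q, ?_⟩
  have hpos : ∀ᶠ ε in 𝓝 (0 : ℝ), ∀ n, 0 ≤ α n * (1 + ε * w n) := by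
    refine eventually_all.2 fun n => ?_
    have : Tendsto (fun ε : ℝ => 1 + ε * w n) (𝓝 0) (𝓝 (1 + 0 * w n)) :=
      (by fun_prop : Continuous fun ε : ℝ => 1 + ε * w n).tendsto 0
    filter_upwards [this.eventually (lt_mem_nhds (by simp : (0 : ℝ) < 1 + 0 * w n))] with ε hε
    exact mul_nonneg (hα n) hε.le
  have hopt : ∀ᶠ ε in 𝓝 (0 : ℝ), ∀ k n,
      α n * (1 + ε * w n) * (c n k : ℕ) ≤ α (q k) * (1 + ε * w (q k)) * (c (q k) k : ℕ) := by
    refine eventually_all.2 fun k => eventually_all.2 fun n => ?_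
    rcases (hq k n).lt_or_eq with hlt | heq
    · have h1 : Continuous fun ε : ℝ => α n * (1 + ε * w n) * ((c n k : ℕ) : ℝ) := by fun_prop
      have h2 : Continuous fun ε : ℝ => α (q k) * (1 + ε * w (q k)) * ((c (q k) k : ℕ) : ℝ) := by
        fun_prop
      filter_upwards [(h1.tendsto 0).eventually_lt (h2.tendsto 0) (by simpa using hlt)] with ε hε
      exact hε.le
    · -- a tie: either both weights vanish, or `n` and `q k` lie on the same side of the splitting
      refine Eventually.of_forall fun ε => le_of_eq ?_
      have key : α n * (c n k : ℕ) = 0 ∨ w n = w (q k) := by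
        by_contra! hcon
        obtain ⟨h0, hne⟩ := hcon
        have h0' := heq ▸ h0
        have hn : α n ≠ 0 ∧ (c n k : ℕ) ≠ 0 := by
          rw [mul_ne_zero_iff] at h0; exact_mod_cast h0
        have hn' : α (q k) ≠ 0 ∧ (c (q k) k : ℕ) ≠ 0 := by
          rw [mul_ne_zero_iff] at h0'; exact_mod_cast h0'
        have b1 : (c n k : ℕ) ≤ M := Nat.lt_succ_iff.1 (c n k).2
        have b2 : (c (q k) k : ℕ) ≤ M := Nat.lt_succ_iff.1 (c (q k) k).2
        by_cases hnU : n ∈ U <;> by_cases hqU : q k ∈ U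
        · exact hne (hw _ _ (by simp [hnU, hqU]))
        · exact hU _ hnU _ hqU _ _ b1 b2 hn.1 hn'.1 hn.2 hn'.2 heq
        · exact hU _ hqU _ hnU _ _ b2 b1 hn'.1 hn.1 hn'.2 hn.2 heq.symm
        · exact hne (hw _ _ (by simp [hnU, hqU]))
      rcases key with h0 | hwn
      · linear_combination (1 + ε * w n) * h0 - (1 + ε * w (q k)) * (h0 - heq)
      · rw [hwn]
        linear_combination (1 + ε * w (q k)) * heq
  filter_upwards [hpos, hopt] with ε h1 h2 J
  exact weight_le_weight_serveQueue h1 c q h2 J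

/-- Under the hypotheses of `eventually_exists_common_optimum`, the maximal mean weight is affine
along the segment of small perturbations; only the inequality not given by convexity is stated. -/
lemma eventually_maxMeanWeight_add_le [Nonempty (Fin N)] {p : ChannelState N K M → ℝ}
    (hp : ∀ s, 0 ≤ p s) {α : Fin N → ℝ} (hα : ∀ n, 0 ≤ α n) {U : Set (Fin N)}
    (hU : ∀ i ∈ U, ∀ j ∈ Uᶜ, ∀ m n : ℕ, m ≤ M → n ≤ M → α i ≠ 0 → α j ≠ 0 → m ≠ 0 → n ≠ 0 →
      α i * m ≠ α j * n)
    {w : Fin N → ℝ} (hw : ∀ i j, (i ∈ U ↔ j ∈ U) → w i = w j) :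
    ∀ᶠ ε in 𝓝 (0 : ℝ),
      maxMeanWeight p (fun n => α n * (1 + ε * w n)) +
        maxMeanWeight p (fun n => α n * (1 + (-ε) * w n)) ≤ 2 * maxMeanWeight p α := by
  choose I hI using eventually_exists_common_optimum (K := K) hα hU hw
  have hI' := eventually_all.2 hI
  have hneg : Tendsto (fun ε : ℝ => -ε) (𝓝 0) (𝓝 0) := by
    simpa using (continuous_neg (G := ℝ)).tendsto 0
  filter_upwards [hI', hneg.eventually hI'] with ε h1 h2
  unfold maxMeanWeight
  rw [← Finset.sum_add_distrib, Finset.mul_sum]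
  refine Finset.sum_le_sum fun s _ => ?_
  have e1 := ciSup_le (h1 s)
  have e2 := ciSup_le (h2 s)
  have e3 := weight_le_iSup α s (I s)
  have e4 : weight (fun n => α n * (1 + ε * w n)) s (I s) +
      weight (fun n => α n * (1 + (-ε) * w n)) s (I s) = 2 * weight α s (I s) := by
    unfold weight
    rw [← Finset.sum_add_distrib, Finset.mul_sum]
    exact Finset.sum_congr rfl fun n _ => by ring
  rw [← mul_add, mul_left_comm]
  exact mul_le_mul_of_nonneg_left (by linarith) (hp s)

/-- The linear inequalities `α y ≤ ∑ₛ πₛ max_I α (Cₛ ⊛ I) 1ᵀ`, `α ≥ 0`, follow from those with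
`α ∈ V`. -/
theorem sum_mul_le_maxMeanWeight_of_V [Nonempty (Fin N)] {p : ChannelState N K M → ℝ}
    (hp : ∀ s, 0 ≤ p s) {y : Fin N → ℝ}
    (hV : ∀ α ∈ V N M, α ≠ 0 → ∑ n, α n * y n ≤ maxMeanWeight p α)
    {α : Fin N → ℝ} (hα : ∀ n, 0 ≤ α n) : ∑ n, α n * y n ≤ maxMeanWeight p α := by
  set f : (Fin N → ℝ) → ℝ := fun β => maxMeanWeight p β - ∑ n, β n * y n with hf
  have hfc : Continuous f := by
    have := continuous_maxMeanWeight p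
    fun_prop
  have hΔ : IsCompact (stdSimplex ℝ (Fin N)) := isCompact_stdSimplex ℝ (Fin N)
  have hΔne : (stdSimplex ℝ (Fin N)).Nonempty :=
    ⟨_, single_mem_stdSimplex ℝ (Classical.arbitrary (Fin N))⟩
  obtain ⟨β₀, hβ₀, hmin⟩ := hΔ.exists_isMinOn hΔne hfc.continuousOn
  set F : Set (Fin N → ℝ) := stdSimplex ℝ (Fin N) ∩ f ⁻¹' {f β₀}
  have hF : IsCompact F := hΔ.inter_right (isClosed_singleton.preimage hfc)
  -- among the minimizers take one with largest Euclidean norm: it is not a midpoint of two others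
  obtain ⟨β, hβF, hmax⟩ := hF.exists_isMaxOn ⟨β₀, hβ₀, rfl⟩
    (by fun_prop : Continuous fun β : Fin N → ℝ => ∑ n, β n ^ 2).continuousOn
  obtain ⟨hβ, hβmin⟩ := hβF
  have hβmin : f β = f β₀ := hβmin
  have hβV : β ∈ V N M := by
    refine ⟨hβ.1, fun U hUi hUj => ?_⟩
    by_contra hcon
    have hU : ∀ i ∈ U, ∀ j ∈ Uᶜ, ∀ m n : ℕ, m ≤ M → n ≤ M → β i ≠ 0 → β j ≠ 0 → m ≠ 0 →
        n ≠ 0 → β i * m ≠ β j * n := fun i hi j hj m n hm hn h1 h2 h3 h4 h5 =>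
      hcon ⟨i, hi, j, hj, m, n, hm, hn, h1, h2, h3, h4, h5⟩
    classical
    obtain ⟨i, hi, hi0⟩ := hUi
    obtain ⟨j, hj, hj0⟩ := hUj
    set a := ∑ n, if n ∈ U then β n else 0 with ha
    set b := ∑ n, if n ∈ U then 0 else β n with hb
    have hbpos : 0 < b := by
      refine Finset.sum_pos' (fun n _ => ?_) ⟨j, Finset.mem_univ _, ?_⟩
      · split_ifs
        · exact le_rfl
        · exact hβ.1 n
      · rw [if_neg hj]
        exact lt_of_le_of_ne (hβ.1 j) (Ne.symm hj0)
    -- the perturbation `β n * (1 + ε * w n)` keeps the sum of the coordinates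
    set w : Fin N → ℝ := fun n => if n ∈ U then b else -a with hw
    have hsum : ∑ n, β n * w n = 0 := by
      have : ∀ n, β n * w n = (if n ∈ U then β n else 0) * b - (if n ∈ U then 0 else β n) * a :=
        fun n => by simp only [hw]; split_ifs <;> ring
      simp_rw [this]
      rw [Finset.sum_sub_distrib, ← Finset.sum_mul, ← Finset.sum_mul, ← ha, ← hb]
      ring
    have hwU : ∀ i j, (i ∈ U ↔ j ∈ U) → w i = w j := fun i j hij => by
      simp only [hw, hij]
    have hpos : ∀ᶠ ε in 𝓝 (0 : ℝ), ∀ n, 0 ≤ 1 + ε * w n ∧ 0 ≤ 1 + (-ε) * w n := by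
      refine eventually_all.2 fun n => ?_
      have h1 : Continuous fun ε : ℝ => 1 + ε * w n := by fun_prop
      have h2 : Continuous fun ε : ℝ => 1 + (-ε) * w n := by fun_prop
      filter_upwards [(h1.tendsto 0).eventually (lt_mem_nhds (by simp : (0 : ℝ) < 1 + 0 * w n)),
        (h2.tendsto 0).eventually (lt_mem_nhds (by simp : (0 : ℝ) < 1 + (-0) * w n))] with ε k1 k2
      exact ⟨k1.le, k2.le⟩
    have hev := (hpos.and (eventually_maxMeanWeight_add_le hp hβ.1 hU hwU)).filter_mono
      (nhdsWithin_le_nhds (s := {0}ᶜ))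
    obtain ⟨ε, ⟨hε1, hε2⟩, hε0⟩ := (hev.and self_mem_nhdsWithin).exists
    have hε0 : ε ≠ 0 := hε0
    have hmem : ∀ η : ℝ, (∀ n, 0 ≤ 1 + η * w n) →
        (fun n => β n * (1 + η * w n)) ∈ stdSimplex ℝ (Fin N) := fun η hη => by
      refine ⟨fun n => mul_nonneg (hβ.1 n) (hη n), ?_⟩
      calc ∑ n, β n * (1 + η * w n) = ∑ n, β n + η * ∑ n, β n * w n := by
            rw [Finset.mul_sum, ← Finset.sum_add_distrib]
            exact Finset.sum_congr rfl fun n _ => by ring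
        _ = 1 := by rw [hsum, hβ.2]; ring
    have m1 := hmem ε fun n => (hε1 n).1
    have m2 := hmem (-ε) fun n => (hε1 n).2
    have l1 : f β₀ ≤ f _ := hmin m1
    have l2 : f β₀ ≤ f _ := hmin m2
    have l3 : f (fun n => β n * (1 + ε * w n)) + f (fun n => β n * (1 + (-ε) * w n)) ≤
        2 * f β := by
      have : ∑ n, β n * (1 + ε * w n) * y n + ∑ n, β n * (1 + (-ε) * w n) * y n =
          2 * ∑ n, β n * y n := by
        rw [← Finset.sum_add_distrib, Finset.mul_sum]
        exact Finset.sum_congr rfl fun n _ => by ring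
      simp only [hf]
      linarith
    have q1 : ∑ n, (β n * (1 + ε * w n)) ^ 2 ≤ ∑ n, β n ^ 2 :=
      hmax ⟨m1, show f _ = f β₀ by linarith⟩
    have q2 : ∑ n, (β n * (1 + (-ε) * w n)) ^ 2 ≤ ∑ n, β n ^ 2 :=
      hmax ⟨m2, show f _ = f β₀ by linarith⟩
    have q3 : ∑ n, (β n * (1 + ε * w n)) ^ 2 + ∑ n, (β n * (1 + (-ε) * w n)) ^ 2 =
        2 * ∑ n, β n ^ 2 + 2 * ∑ n, (ε * (β n * w n)) ^ 2 := by
      rw [← Finset.sum_add_distrib, Finset.mul_sum, Finset.mul_sum, ← Finset.sum_add_distrib]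
      exact Finset.sum_congr rfl fun n _ => by ring
    have q4 : 0 < ∑ n, (ε * (β n * w n)) ^ 2 := by
      refine Finset.sum_pos' (fun n _ => sq_nonneg _) ⟨i, Finset.mem_univ _, ?_⟩
      have : w i = b := if_pos hi
      rw [this]
      positivity
    linarith
  have hβ0 : β ≠ 0 := by
    rintro rfl
    simpa using hβ.2
  have hfβ : 0 ≤ f β := sub_nonneg.2 (hV β hβV hβ0)
  rcases eq_or_ne α 0 with rfl | hα0
  · have := maxMeanWeight_smul p le_rfl (0 : Fin N → ℝ)
    simp only [smul_zero, zero_mul] at this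
    simp [this]
  · have hS : 0 < ∑ n, α n := by
      obtain ⟨n, hn⟩ := Function.ne_iff.1 hα0
      exact Finset.sum_pos' (fun n _ => hα n)
        ⟨n, Finset.mem_univ _, lt_of_le_of_ne (hα n) (Ne.symm hn)⟩
    set S := ∑ n, α n
    have hmemα : S⁻¹ • α ∈ stdSimplex ℝ (Fin N) := by
      refine ⟨fun n => mul_nonneg (inv_nonneg.2 hS.le) (hα n), ?_⟩
      simp only [Pi.smul_apply, smul_eq_mul, ← Finset.mul_sum]
      exact inv_mul_cancel₀ hS.ne'
    have hle : f β₀ ≤ f (S⁻¹ • α) := hmin hmemα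
    have hfα : f (S⁻¹ • α) = S⁻¹ * (maxMeanWeight p α - ∑ n, α n * y n) := by
      simp only [hf, maxMeanWeight_smul p (inv_nonneg.2 hS.le), Pi.smul_apply, smul_eq_mul,
        mul_assoc, ← Finset.mul_sum]
      ring
    have := hfβ.trans (hβmin.le.trans (hle.trans hfα.le))
    exact sub_nonneg.1 (nonneg_of_mul_nonneg_right this (inv_pos.2 hS))

/-! ### The rate polytope and the slack -/

lemma isCompact_ratePolytope (p : ChannelState N K M → ℝ) : IsCompact (ratePolytope p) :=
  Set.Finite.isCompact_convexHull (𝕜 := ℝ) (Set.finite_range _)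

lemma service_mask (c : ChannelState N K M) (I : Allocation N K) (P : Fin N → Prop)
    [DecidablePred P] (n : Fin N) :
    service c (I.mask P) n = if P n then service c I n else 0 := by
  unfold service Allocation.mask
  split_ifs with h <;> simp [h]

lemma sum_mul_policyRate (p : ChannelState N K M → ℝ) (α : Fin N → ℝ)
    (g : ChannelState N K M → Allocation N K) :
    ∑ n, α n * policyRate p g n = ∑ s, p s * weight α s (g s) := by
  simp only [policyRate, weight, Finset.mul_sum]
  rw [Finset.sum_comm]
  exact Finset.sum_congr rfl fun s _ => Finset.sum_congr rfl fun n _ => by ring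

/-- A nonnegative vector lies in the rate polytope as soon as it satisfies the inequalities indexed
by nonnegative `α`: a separating functional with negative coordinates is no obstruction, because a
policy need not serve the queues at these coordinates. -/
theorem mem_ratePolytope_of_le {p : ChannelState N K M → ℝ} {y : Fin N → ℝ} (hy : ∀ n, 0 ≤ y n)
    (h : ∀ α : Fin N → ℝ, (∀ n, 0 ≤ α n) → ∑ n, α n * y n ≤ maxMeanWeight p α) :
    y ∈ ratePolytope p := by
  by_contra hnot
  obtain ⟨F, u, hF, hu⟩ := geometric_hahn_banach_closed_point (convex_convexHull ℝ _)
    (isCompact_ratePolytope p).isClosed hnot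
  set α : Fin N → ℝ := fun n => F (Pi.single n 1)
  have hFα : ∀ x : Fin N → ℝ, F x = ∑ n, α n * x n := fun x => by
    conv_lhs => rw [pi_eq_sum_univ' x]
    rw [map_sum]
    refine Finset.sum_congr rfl fun n _ => ?_
    rw [map_smul, smul_eq_mul, mul_comm]
  have hopt : ∀ s : ChannelState N K M, ∃ I : Allocation N K, ∀ J,
      weight (fun n => max (α n) 0) s J ≤ weight (fun n => max (α n) 0) s I := fun s =>
    Finite.exists_max _
  choose g hg using hopt
  classical
  have hrate : F (policyRate p fun s => (g s).mask fun n => 0 ≤ α n) =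
      maxMeanWeight p fun n => max (α n) 0 := by
    rw [hFα, sum_mul_policyRate]
    refine Finset.sum_congr rfl fun s _ => ?_
    rw [le_antisymm (ciSup_le (hg s)) (weight_le_iSup _ s (g s))]
    congr 1
    refine Finset.sum_congr rfl fun n _ => ?_
    rw [service_mask]
    split_ifs with h0
    · simp [h0]
    · simp [(not_le.1 h0).le]
  have h1 := hF _ (subset_convexHull ℝ _ ⟨fun s => (g s).mask fun n => 0 ≤ α n, rfl⟩)
  rw [hrate] at h1
  have h2 := h (fun n => max (α n) 0) fun n => le_max_right _ _
  have h3 : F y ≤ ∑ n, max (α n) 0 * y n := by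
    rw [hFα]
    exact Finset.sum_le_sum fun n _ => mul_le_mul_of_nonneg_right (le_max_left _ _) (hy n)
  linarith

lemma finite_W (N M : ℕ) : (W N M).Finite := by
  refine (Set.finite_range fun m : Fin (N - 1) → Fin (M + 1) => ∏ j, (m j : ℕ)).subset ?_
  rintro z ⟨m, hm, rfl⟩
  exact ⟨fun j => ⟨m j, Nat.lt_succ_of_le (hm j)⟩, rfl⟩

lemma IsVHat.finite {S : Set (Fin N → ℝ)} (hS : IsVHat N M S) : S.Finite := by
  refine (Set.Finite.pi' fun _ : Fin N => (finite_W N M).image ((↑) : ℕ → ℝ)).subset ?_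
  intro β hβ n
  obtain ⟨z, hz, h⟩ := hS.entries β hβ n
  exact ⟨z, hz, h.symm⟩

/-- The strict inequalities indexed by `V̂` leave room for a common slack `d`. -/
theorem exists_pos_forall_add_mem_ratePolytope [Nonempty (Fin N)] {p : ChannelState N K M → ℝ}
    (hp : ∀ s, 0 ≤ p s) {S : Set (Fin N → ℝ)} (hS : IsVHat N M S) {a : ℕ → Fin N → ℝ}
    (ha : ∀ t n, 0 ≤ a t n)
    (hstrict : ∀ α ∈ S, ∃ ε : ℝ, 0 < ε ∧ ∀ t, ∑ n, α n * a t n + ε ≤ maxMeanWeight p α) :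
    ∃ d : ℝ, 0 < d ∧ ∀ t, (fun n => a t n + d) ∈ ratePolytope p := by
  have hev : ∀ᶠ d in 𝓝[>] (0 : ℝ), ∀ α ∈ S, ∀ t,
      ∑ n, α n * (a t n + d) ≤ maxMeanWeight p α := by
    refine (eventually_all_finite hS.finite).2 fun α hα => ?_
    obtain ⟨ε, hε, h⟩ := hstrict α hα
    have hc : Continuous fun d : ℝ => (∑ n, α n) * d := by fun_prop
    have h0 := (hc.tendsto 0).eventually (gt_mem_nhds (by simpa using hε : (∑ n, α n) * 0 < ε))
    filter_upwards [nhdsWithin_le_nhds h0] with d hd t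
    have := h t
    simp only [mul_add, Finset.sum_add_distrib, ← Finset.sum_mul]
    linarith
  obtain ⟨d, hd, hd0⟩ := (hev.and self_mem_nhdsWithin).exists
  have hd0 : 0 < d := hd0
  refine ⟨d, hd0, fun t => mem_ratePolytope_of_le (fun n => add_nonneg (ha t n) hd0.le)
    fun α hα => sum_mul_le_maxMeanWeight_of_V hp (fun β hβ hβ0 => ?_) hα⟩
  obtain ⟨γ, hγ, q, hq, rfl⟩ := hS.cover β hβ hβ0
  rw [maxMeanWeight_smul p hq.le]
  simp only [Pi.smul_apply, smul_eq_mul, mul_assoc, ← Finset.mul_sum]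
  exact mul_le_mul_of_nonneg_left (hd γ hγ t) hq.le

lemma exists_isGreatest_slack [Nonempty (Fin N)] {p : ChannelState N K M → ℝ} {a : ℕ → Fin N → ℝ}
    (h : ∃ d : ℝ, 0 < d ∧ ∀ t, (fun n => a t n + d) ∈ ratePolytope p) :
    ∃ δ, IsGreatest {d : ℝ | 0 < d ∧ ∀ t, (fun n => a t n + d) ∈ ratePolytope p} δ := by
  obtain ⟨d₀, hd₀, hmem⟩ := h
  have hP := isCompact_ratePolytope p
  obtain ⟨n⟩ := ‹Nonempty (Fin N)›
  obtain ⟨u, hu⟩ := (hP.image (continuous_apply n)).bddAbove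
  set D : Set ℝ := Set.Icc d₀ (u - a 0 n) ∩
    ⋂ t, (fun d : ℝ => fun n => a t n + d) ⁻¹' ratePolytope p
  have hD : IsCompact D := isCompact_Icc.inter_right
    (isClosed_iInter fun t => hP.isClosed.preimage (by fun_prop))
  have hub : ∀ d : ℝ, (∀ t, (fun n => a t n + d) ∈ ratePolytope p) → d ≤ u - a 0 n :=
    fun d hd => by
      have : a 0 n + d ≤ u := hu ⟨_, hd 0, rfl⟩
      linarith
  obtain ⟨δ, hδ, hmax⟩ := hD.exists_isGreatest
    ⟨d₀, ⟨le_rfl, hub _ hmem⟩, Set.mem_iInter.2 hmem⟩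
  refine ⟨δ, ⟨hd₀.trans_le hδ.1.1, Set.mem_iInter.1 hδ.2⟩, fun d hd => ?_⟩
  rcases le_total d d₀ with hle | hle
  · exact hle.trans hδ.1.1
  · exact hmax ⟨⟨hle, hub d hd.2⟩, Set.mem_iInter.2 hd.2⟩

/-! ### Quadratic Lyapunov drift -/

variable {Ω : Type*} [MeasurableSpace Ω]

lemma sum_service_le (c : ChannelState N K M) (I : Allocation N K) :
    ∑ n, service c I n ≤ M * K := by
  unfold service
  rw [Finset.sum_comm]
  calc ∑ k, ∑ n, (c n k : ℕ) * (I.1 n k : ℕ) ≤ ∑ k : Fin K, M := by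
        refine Finset.sum_le_sum fun k _ => ?_
        calc ∑ n, (c n k : ℕ) * (I.1 n k : ℕ) ≤ ∑ n, M * (I.1 n k : ℕ) :=
              Finset.sum_le_sum fun n _ => Nat.mul_le_mul_right _ (Nat.lt_succ_iff.1 (c n k).2)
          _ = M * ∑ n, (I.1 n k : ℕ) := by rw [Finset.mul_sum]
          _ ≤ M * 1 := Nat.mul_le_mul_left _ (I.2 k)
          _ = M := mul_one _
    _ = M * K := by simp [mul_comm]

lemma sum_service_sq_le (c : ChannelState N K M) (I : Allocation N K) :
    ∑ n, service c I n ^ 2 ≤ (M * K) ^ 2 :=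
  (Finset.sum_sq_le_sq_sum_of_nonneg fun _ _ => Nat.zero_le _).trans
    (Nat.pow_le_pow_left (sum_service_le c I) 2)

lemma tsub_add_sq_add_le (x s a : ℕ) :
    (x - s + a) ^ 2 + 2 * (x * s) ≤ x ^ 2 + s ^ 2 + a ^ 2 + 2 * (x * a) := by
  rcases le_total s x with h | h
  · obtain ⟨y, rfl⟩ := Nat.exists_eq_add_of_le h
    rw [Nat.add_sub_cancel_left]
    nlinarith
  · rw [Nat.sub_eq_zero_of_le h]
    obtain ⟨y, rfl⟩ := Nat.exists_eq_add_of_le h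
    nlinarith

namespace IsSystem

variable {μ : Measure Ω} {p : ChannelState N K M → ℝ} {Amax : ℝ}
  {A : ℕ → Ω → Fin N → ℕ} {C : ℕ → Ω → ChannelState N K M}
  {I : ℕ → Ω → Allocation N K} {X : ℕ → Ω → Fin N → ℕ}

lemma measurable_queue (h : IsSystem μ p Amax A C I X) (t : ℕ) : Measurable (X t) := by
  induction t with
  | zero => exact h.measurable_X
  | succ t ih =>
    have : X (t + 1) = fun ω => (fun z : (Fin N → ℕ) × (Fin N → ℕ) × ChannelState N K M ×
        Allocation N K => fun n => (z.1 n - service z.2.2.1 z.2.2.2 n) + z.2.1 n)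
          (X t ω, A (t + 1) ω, C (t + 1) ω, I (t + 1) ω) := by
      ext ω n
      exact h.evolution t ω n
    rw [this]
    exact (Measurable.of_discrete (f := fun z : (Fin N → ℕ) × (Fin N → ℕ) × ChannelState N K M ×
        Allocation N K => fun n => (z.1 n - service z.2.2.1 z.2.2.2 n) + z.2.1 n)).comp
      (ih.prodMk ((h.measurable_A t).prodMk ((h.measurable_C t).prodMk (h.measurable_I t))))

/-- A function of the arrivals in a slot is uncorrelated with a function of the initial and the
current queue lengths. -/
lemma lintegral_mul_arrival (h : IsSystem μ p Amax A C I X) (t : ℕ)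
    (ψ : (Fin N → ℕ) → (Fin N → ℕ) → ℝ≥0∞) (φ : (Fin N → ℕ) → ℝ≥0∞) :
    ∫⁻ ω, ψ (X 0 ω) (X t ω) * φ (A (t + 1) ω) ∂μ =
      (∫⁻ ω, ψ (X 0 ω) (X t ω) ∂μ) * ∫⁻ ω, φ (A (t + 1) ω) ∂μ := by
  have hind := ((h.indep_arrival t).comp (φ := φ)
    (ψ := fun H : Fin (t + 1) → Fin N → ℕ => ψ (H 0) (H (Fin.last t)))
    Measurable.of_discrete Measurable.of_discrete).symm
  have h0 := h.measurable_queue 0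
  have h1 := h.measurable_queue t
  exact lintegral_mul_eq_lintegral_mul_lintegral_of_indepFun''
    ((Measurable.of_discrete (f := Function.uncurry ψ)).comp (h0.prodMk h1)).aemeasurable
    ((Measurable.of_discrete (f := φ)).comp (h.measurable_A t)).aemeasurable hind

/-- A function of the channel state in a slot is uncorrelated with a function of the initial and
the current queue lengths. -/
lemma lintegral_mul_channel (h : IsSystem μ p Amax A C I X) (t : ℕ)
    (ψ : (Fin N → ℕ) → (Fin N → ℕ) → ℝ≥0∞) (φ : ChannelState N K M → ℝ≥0∞) :
    ∫⁻ ω, ψ (X 0 ω) (X t ω) * φ (C (t + 1) ω) ∂μ =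
      (∫⁻ ω, ψ (X 0 ω) (X t ω) ∂μ) * ∑ s, φ s * ENNReal.ofReal (p s) := by
  have hind := ((h.indep_channel t).comp (φ := φ)
    (ψ := fun H : Fin (t + 1) → Fin N → ℕ => ψ (H 0) (H (Fin.last t)))
    Measurable.of_discrete Measurable.of_discrete).symm
  have h0 := h.measurable_queue 0
  have h1 := h.measurable_queue t
  have hC : ∫⁻ ω, φ (C (t + 1) ω) ∂μ = ∑ s, φ s * ENNReal.ofReal (p s) := by
    rw [← lintegral_map (f := φ) Measurable.of_discrete (h.measurable_C t), lintegral_fintype]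
    refine Finset.sum_congr rfl fun s _ => ?_
    rw [Measure.map_apply (h.measurable_C t) (measurableSet_singleton s), ← h.channel_law t s]
    rfl
  rw [← hC]
  exact lintegral_mul_eq_lintegral_mul_lintegral_of_indepFun''
    ((Measurable.of_discrete (f := Function.uncurry ψ)).comp (h0.prodMk h1)).aemeasurable
    ((Measurable.of_discrete (f := φ)).comp (h.measurable_C t)).aemeasurable hind

lemma lintegral_arrival_le (h : IsSystem μ p Amax A C I X) (t : ℕ) (n : Fin N) :
    ∫⁻ ω, (A (t + 1) ω n : ℝ≥0∞) ∂μ ≤ ENNReal.ofReal (Amax ^ 2) := by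
  refine le_trans (lintegral_mono fun ω => ?_) (h.arrival_sq t n)
  -- an integer is at most its square
  rw [← Nat.cast_pow]
  exact Nat.cast_le.2 (Nat.le_self_pow two_ne_zero _)

lemma ofReal_meanArrival (h : IsSystem μ p Amax A C I X) (t : ℕ) (n : Fin N) :
    ENNReal.ofReal (meanArrival μ A (t + 1) n) = ∫⁻ ω, (A (t + 1) ω n : ℝ≥0∞) ∂μ := by
  have hm : Measurable fun ω => (A (t + 1) ω n : ℝ) :=
    (Measurable.of_discrete (f := fun a : Fin N → ℕ => (a n : ℝ))).comp (h.measurable_A t)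
  have hfin : ∫⁻ ω, (A (t + 1) ω n : ℝ≥0∞) ∂μ ≠ ⊤ :=
    ((h.lintegral_arrival_le t n).trans_lt ENNReal.ofReal_lt_top).ne
  rw [meanArrival, integral_eq_lintegral_of_nonneg_ae (ae_of_all _ fun ω => Nat.cast_nonneg _)
    hm.aestronglyMeasurable]
  simp only [ENNReal.ofReal_natCast]
  exact ENNReal.ofReal_toReal hfin

lemma measurable_queue_comp (h : IsSystem μ p Amax A C I X) (t : ℕ)
    (ψ : (Fin N → ℕ) → (Fin N → ℕ) → ℝ≥0∞) : Measurable fun ω => ψ (X 0 ω) (X t ω) :=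
  (Measurable.of_discrete (f := Function.uncurry ψ)).comp
    ((h.measurable_queue 0).prodMk (h.measurable_queue t))

/-- Discarding all departures bounds the growth of the queues. The weight `ρ (X 0)` serves to
restrict the expectation to an event determined by `X 0`. -/
lemma lintegral_queue_le (h : IsSystem μ p Amax A C I X) (ρ : (Fin N → ℕ) → ℝ≥0∞) (n : Fin N)
    (t : ℕ) :
    ∫⁻ ω, ρ (X 0 ω) * X t ω n ∂μ ≤
      ∫⁻ ω, ρ (X 0 ω) * X 0 ω n ∂μ + t * (ENNReal.ofReal (Amax ^ 2) * ∫⁻ ω, ρ (X 0 ω) ∂μ) := by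
  induction t with
  | zero => simp
  | succ t ih =>
    calc ∫⁻ ω, ρ (X 0 ω) * X (t + 1) ω n ∂μ
        ≤ ∫⁻ ω, ρ (X 0 ω) * X t ω n + ρ (X 0 ω) * A (t + 1) ω n ∂μ := by
          refine lintegral_mono fun ω => ?_
          rw [← mul_add]
          gcongr
          rw [h.evolution t ω n]
          exact_mod_cast Nat.add_le_add_right (Nat.sub_le _ _) _
      _ = ∫⁻ ω, ρ (X 0 ω) * X t ω n ∂μ +
            (∫⁻ ω, ρ (X 0 ω) ∂μ) * ∫⁻ ω, (A (t + 1) ω n : ℝ≥0∞) ∂μ := by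
          rw [lintegral_add_left (h.measurable_queue_comp t fun x y => ρ x * y n)]
          congr 1
          exact h.lintegral_mul_arrival t (fun x _ => ρ x) fun a => (a n : ℝ≥0∞)
      _ ≤ _ := by
          grw [ih, h.lintegral_arrival_le t n]
          push_cast
          exact le_of_eq (by ring)

variable [IsProbabilityMeasure μ]

lemma lintegral_queue_lt_top (h : IsSystem μ p Amax A C I X) {ρ : (Fin N → ℕ) → ℝ≥0∞}
    (hρ : ∀ x, ρ x ≤ 1) (n : Fin N) (t : ℕ) : ∫⁻ ω, ρ (X 0 ω) * X t ω n ∂μ < ⊤ := by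
  refine (h.lintegral_queue_le ρ n t).trans_lt ?_
  have h1 : ∫⁻ ω, ρ (X 0 ω) * X 0 ω n ∂μ < ⊤ :=
    (lintegral_mono fun ω => mul_le_of_le_one_left' (hρ _)).trans_lt (h.initial n)
  have h2 : ∫⁻ ω, ρ (X 0 ω) ∂μ < ⊤ :=
    ((lintegral_mono fun ω => hρ _).trans_eq (by simp : ∫⁻ _, (1 : ℝ≥0∞) ∂μ = 1)).trans_lt
      ENNReal.one_lt_top
  exact ENNReal.add_lt_top.2 ⟨h1, ENNReal.mul_lt_top (ENNReal.natCast_lt_top t)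
    (ENNReal.mul_lt_top ENNReal.ofReal_lt_top h2)⟩

/-- Maximum Weight serves the queues, weighted by their lengths, at least as well as any rate
vector of the polytope would: a policy based on the channel state alone is one of the competitors
in the maximization. -/
lemma sum_mul_lintegral_le_service (h : IsSystem μ p Amax A C I X) (hMW : IsMaxWeight C I X)
    {ρ : (Fin N → ℕ) → ℝ≥0∞} (hρ : ∀ x, ρ x ≤ 1) (t : ℕ) {y : Fin N → ℝ} (hy : ∀ n, 0 ≤ y n)
    (hyP : y ∈ ratePolytope p) :
    ∑ n, ENNReal.ofReal (y n) * ∫⁻ ω, ρ (X 0 ω) * X t ω n ∂μ ≤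
      ∫⁻ ω, ρ (X 0 ω) *
        ((∑ n, X t ω n * service (C (t + 1) ω) (I (t + 1) ω) n : ℕ) : ℝ≥0∞) ∂μ := by
  set c := ∫⁻ ω, ρ (X 0 ω) *
    ((∑ n, X t ω n * service (C (t + 1) ω) (I (t + 1) ω) n : ℕ) : ℝ≥0∞) ∂μ
  rcases eq_or_ne c ⊤ with htop | htop
  · rw [htop]; exact le_top
  set m : Fin N → ℝ := fun n => (∫⁻ ω, ρ (X 0 ω) * X t ω n ∂μ).toReal
  have hmn : ∀ n, ∫⁻ ω, ρ (X 0 ω) * X t ω n ∂μ = ENNReal.ofReal (m n) := fun n =>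
    (ENNReal.ofReal_toReal (h.lintegral_queue_lt_top hρ n t).ne).symm
  have hm0 : ∀ n, 0 ≤ m n := fun n => ENNReal.toReal_nonneg
  have hsum : ∀ z : Fin N → ℝ, (∀ n, 0 ≤ z n) →
      ∑ n, ENNReal.ofReal (z n) * ∫⁻ ω, ρ (X 0 ω) * X t ω n ∂μ =
        ENNReal.ofReal (∑ n, z n * m n) := fun z hz => by
    rw [ENNReal.ofReal_sum_of_nonneg fun n _ => mul_nonneg (hz n) (hm0 n)]
    exact Finset.sum_congr rfl fun n _ => by rw [hmn, ENNReal.ofReal_mul (hz n)]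
  -- the vectors satisfying the claim form a half-space, so the vertices suffice
  have hhalf : ratePolytope p ⊆ {z | ∑ n, z n * m n ≤ c.toReal} := by
    refine convexHull_min ?_ (convex_halfSpace_le (f := fun z : Fin N → ℝ => ∑ n, z n * m n)
      ⟨fun a b => ?_, fun r a => ?_⟩ _)
    · rintro _ ⟨g, rfl⟩
      have hg0 : ∀ n, 0 ≤ policyRate p g n := fun n =>
        Finset.sum_nonneg fun s _ => mul_nonneg (h.p_nonneg s) (Nat.cast_nonneg _)
      refine (ENNReal.ofReal_le_iff_le_toReal htop).1 ?_
      rw [← hsum _ hg0]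
      have hrate : ∀ n, ENNReal.ofReal (policyRate p g n) =
          ∑ s, (service s (g s) n : ℝ≥0∞) * ENNReal.ofReal (p s) := fun n => by
        rw [policyRate,
          ENNReal.ofReal_sum_of_nonneg fun s _ => mul_nonneg (h.p_nonneg s) (Nat.cast_nonneg _)]
        refine Finset.sum_congr rfl fun s _ => ?_
        rw [ENNReal.ofReal_mul (h.p_nonneg s), ENNReal.ofReal_natCast, mul_comm]
      calc ∑ n, ENNReal.ofReal (policyRate p g n) * ∫⁻ ω, ρ (X 0 ω) * X t ω n ∂μ
          = ∑ n, ∫⁻ ω, ρ (X 0 ω) * X t ω n *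
              (service (C (t + 1) ω) (g (C (t + 1) ω)) n : ℝ≥0∞) ∂μ := by
            refine Finset.sum_congr rfl fun n _ => ?_
            rw [hrate, mul_comm]
            exact (h.lintegral_mul_channel t (fun x y => ρ x * y n)
              fun s => (service s (g s) n : ℝ≥0∞)).symm
        _ = ∫⁻ ω, ∑ n, ρ (X 0 ω) * X t ω n *
              (service (C (t + 1) ω) (g (C (t + 1) ω)) n : ℝ≥0∞) ∂μ := by
            refine (lintegral_finsetSum _ fun n _ => ?_).symm
            exact (h.measurable_queue_comp t fun x y => ρ x * y n).mul
              ((Measurable.of_discrete (f := fun s => (service s (g s) n : ℝ≥0∞))).comp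
                (h.measurable_C t))
        _ ≤ c := by
            refine lintegral_mono fun ω => ?_
            have hw := hMW t ω (g (C (t + 1) ω))
            simp only [weight] at hw
            have hw' : ∑ n, X t ω n * service (C (t + 1) ω) (g (C (t + 1) ω)) n ≤
                ∑ n, X t ω n * service (C (t + 1) ω) (I (t + 1) ω) n := by exact_mod_cast hw
            simp only [mul_assoc, ← Finset.mul_sum]
            gcongr
            exact_mod_cast hw'
    · simp [add_mul, Finset.sum_add_distrib]
    · simp [mul_assoc, Finset.mul_sum]
  rw [hsum y hy]
  exact (ENNReal.ofReal_le_iff_le_toReal htop).2 (hhalf hyP)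

/-- The one-slot drift of the quadratic Lyapunov function `∑ n, X n ^ 2`, without subtractions. -/
lemma lyapunov_drift (h : IsSystem μ p Amax A C I X) (hMW : IsMaxWeight C I X)
    {ρ : (Fin N → ℕ) → ℝ≥0∞} (hρ : ∀ x, ρ x ≤ 1) {δ : ℝ} (hδ : 0 ≤ δ) (t : ℕ)
    (hP : (fun n => meanArrival μ A (t + 1) n + δ) ∈ ratePolytope p) :
    ∫⁻ ω, ρ (X 0 ω) * ((∑ n, X (t + 1) ω n ^ 2 : ℕ) : ℝ≥0∞) ∂μ +
        2 * (ENNReal.ofReal δ * ∑ n, ∫⁻ ω, ρ (X 0 ω) * X t ω n ∂μ) ≤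
      ∫⁻ ω, ρ (X 0 ω) * ((∑ n, X t ω n ^ 2 : ℕ) : ℝ≥0∞) ∂μ +
        ENNReal.ofReal (N * Amax ^ 2 + ((M : ℝ) * K) ^ 2) := by
  have ha : ∀ n, 0 ≤ meanArrival μ A (t + 1) n := fun n =>
    integral_nonneg fun ω => Nat.cast_nonneg _
  set a : Fin N → ℝ≥0∞ := fun n => ∫⁻ ω, (A (t + 1) ω n : ℝ≥0∞) ∂μ
  set m : Fin N → ℝ≥0∞ := fun n => ∫⁻ ω, ρ (X 0 ω) * X t ω n ∂μ
  have hserv := h.sum_mul_lintegral_le_service hMW hρ t (fun n => add_nonneg (ha n) hδ) hP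
  have hsplit : ∑ n, ENNReal.ofReal (meanArrival μ A (t + 1) n + δ) * m n =
      ∑ n, a n * m n + ENNReal.ofReal δ * ∑ n, m n := by
    rw [Finset.mul_sum, ← Finset.sum_add_distrib]
    refine Finset.sum_congr rfl fun n _ => ?_
    rw [ENNReal.ofReal_add (ha n) hδ, h.ofReal_meanArrival, add_mul]
  rw [hsplit] at hserv
  have hfin : 2 * ∑ n, a n * m n ≠ ⊤ := by
    refine ENNReal.mul_ne_top (by simp) (ENNReal.sum_ne_top.2 fun n _ => ENNReal.mul_ne_top ?_ ?_)
    · exact ((h.lintegral_arrival_le t n).trans_lt ENNReal.ofReal_lt_top).ne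
    · exact (h.lintegral_queue_lt_top hρ n t).ne
  have hcross : ∫⁻ ω, ρ (X 0 ω) * ((∑ n, X t ω n * A (t + 1) ω n : ℕ) : ℝ≥0∞) ∂μ =
      ∑ n, a n * m n := by
    have : ∀ ω, ρ (X 0 ω) * ((∑ n, X t ω n * A (t + 1) ω n : ℕ) : ℝ≥0∞) =
        ∑ n, ρ (X 0 ω) * X t ω n * A (t + 1) ω n := fun ω => by
      push_cast
      simp only [Finset.mul_sum, mul_assoc]
    simp_rw [this]
    rw [lintegral_finsetSum]
    · refine Finset.sum_congr rfl fun n _ => ?_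
      rw [mul_comm]
      exact h.lintegral_mul_arrival t (fun x y => ρ x * y n) fun a => (a n : ℝ≥0∞)
    · intro n _
      exact (h.measurable_queue_comp t fun x y => ρ x * y n).mul
        ((Measurable.of_discrete (f := fun a : Fin N → ℕ => (a n : ℝ≥0∞))).comp (h.measurable_A t))
  have hmA : Measurable fun ω => ((∑ n, A (t + 1) ω n ^ 2 : ℕ) : ℝ≥0∞) :=
    (Measurable.of_discrete (f := fun a : Fin N → ℕ => ((∑ n, a n ^ 2 : ℕ) : ℝ≥0∞))).comp
      (h.measurable_A t)
  have hsq : ∫⁻ ω, ((∑ n, A (t + 1) ω n ^ 2 : ℕ) : ℝ≥0∞) + ((M * K : ℕ) : ℝ≥0∞) ^ 2 ∂μ ≤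
      ENNReal.ofReal (N * Amax ^ 2 + ((M : ℝ) * K) ^ 2) := by
    rw [lintegral_add_left hmA, lintegral_const, measure_univ, mul_one,
      ENNReal.ofReal_add (by positivity) (by positivity)]
    gcongr
    · push_cast
      rw [lintegral_finsetSum]
      · calc ∑ n, ∫⁻ ω, (A (t + 1) ω n : ℝ≥0∞) ^ 2 ∂μ
            ≤ ∑ _n : Fin N, ENNReal.ofReal (Amax ^ 2) :=
              Finset.sum_le_sum fun n _ => h.arrival_sq t n
          _ = ENNReal.ofReal (N * Amax ^ 2) := by
              rw [ENNReal.ofReal_mul (Nat.cast_nonneg _)]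
              simp
      · intro n _
        exact (Measurable.of_discrete (f := fun a : Fin N → ℕ => (a n : ℝ≥0∞) ^ 2)).comp
          (h.measurable_A t)
    · rw [ENNReal.ofReal_pow (by positivity), ENNReal.ofReal_mul (Nat.cast_nonneg _)]
      simp
  have hpt : ∀ ω, ∑ n, X (t + 1) ω n ^ 2 +
        2 * ∑ n, X t ω n * service (C (t + 1) ω) (I (t + 1) ω) n ≤
      ∑ n, X t ω n ^ 2 + (∑ n, A (t + 1) ω n ^ 2 + (M * K) ^ 2) +
        2 * ∑ n, X t ω n * A (t + 1) ω n := fun ω => by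
    have h1 := Finset.sum_le_sum fun (n : Fin N) (_ : n ∈ Finset.univ) =>
      tsub_add_sq_add_le (X t ω n) (service (C (t + 1) ω) (I (t + 1) ω) n) (A (t + 1) ω n)
    simp only [← h.evolution, Finset.sum_add_distrib, ← Finset.mul_sum] at h1
    have h2 := sum_service_sq_le (C (t + 1) ω) (I (t + 1) ω)
    omega
  set L : ℕ → ℝ≥0∞ := fun t => ∫⁻ ω, ρ (X 0 ω) * ((∑ n, X t ω n ^ 2 : ℕ) : ℝ≥0∞) ∂μ with hL
  set B := ENNReal.ofReal (N * Amax ^ 2 + ((M : ℝ) * K) ^ 2)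
  set S := ∫⁻ ω, ρ (X 0 ω) *
    ((∑ n, X t ω n * service (C (t + 1) ω) (I (t + 1) ω) n : ℕ) : ℝ≥0∞) ∂μ with hS
  have hmain : L (t + 1) + 2 * S ≤ L t + B + 2 * ∑ n, a n * m n := by
    have hmL : ∀ τ, Measurable fun ω => ρ (X 0 ω) * ((∑ n, X τ ω n ^ 2 : ℕ) : ℝ≥0∞) := fun τ =>
      h.measurable_queue_comp τ fun x y => ρ x * ((∑ n, y n ^ 2 : ℕ) : ℝ≥0∞)
    calc L (t + 1) + 2 * S
        = ∫⁻ ω, ρ (X 0 ω) * ((∑ n, X (t + 1) ω n ^ 2 +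
            2 * ∑ n, X t ω n * service (C (t + 1) ω) (I (t + 1) ω) n : ℕ) : ℝ≥0∞) ∂μ := by
          rw [hS, ← lintegral_const_mul' _ _ (by simp), hL, ← lintegral_add_left (hmL _)]
          refine lintegral_congr fun ω => ?_
          rw [Nat.cast_add, Nat.cast_mul 2, mul_add, mul_left_comm]
          norm_num
      _ ≤ ∫⁻ ω, (ρ (X 0 ω) * ((∑ n, X t ω n ^ 2 : ℕ) : ℝ≥0∞) +
            (((∑ n, A (t + 1) ω n ^ 2 : ℕ) : ℝ≥0∞) + ((M * K : ℕ) : ℝ≥0∞) ^ 2)) +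
            2 * (ρ (X 0 ω) * ((∑ n, X t ω n * A (t + 1) ω n : ℕ) : ℝ≥0∞)) ∂μ := by
          refine lintegral_mono fun ω => ?_
          have := mul_le_mul_right (Nat.cast_le (α := ℝ≥0∞).2 (hpt ω)) (ρ (X 0 ω))
          refine this.trans ?_
          rw [Nat.cast_add, Nat.cast_add, Nat.cast_mul 2, mul_add, mul_add,
            mul_left_comm _ ((2 : ℕ) : ℝ≥0∞)]
          gcongr
          · push_cast
            exact mul_le_of_le_one_left' (hρ _)
          · norm_num
      _ ≤ L t + B + 2 * ∑ n, a n * m n := by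
          have hm2 : Measurable fun ω => ρ (X 0 ω) * ((∑ n, X t ω n ^ 2 : ℕ) : ℝ≥0∞) +
              (((∑ n, A (t + 1) ω n ^ 2 : ℕ) : ℝ≥0∞) + ((M * K : ℕ) : ℝ≥0∞) ^ 2) :=
            (hmL t).add (hmA.add measurable_const)
          rw [lintegral_add_left hm2,
            lintegral_add_left (hmL t), lintegral_const_mul' _ _ (by simp), hcross]
          gcongr
  have : L (t + 1) + 2 * (ENNReal.ofReal δ * ∑ n, m n) + 2 * ∑ n, a n * m n ≤
      L t + B + 2 * ∑ n, a n * m n := by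
    refine le_trans (le_of_eq ?_)
      ((add_le_add_right (mul_le_mul_right hserv 2) (L (t + 1))).trans hmain)
    ring
  exact (ENNReal.add_le_add_iff_right hfin).1 this

/-- Summed drift: the Lyapunov function at time `t` is dropped. -/
lemma sum_backlog_le (h : IsSystem μ p Amax A C I X) (hMW : IsMaxWeight C I X)
    {ρ : (Fin N → ℕ) → ℝ≥0∞} (hρ : ∀ x, ρ x ≤ 1) {δ : ℝ} (hδ : 0 ≤ δ)
    (hP : ∀ t, (fun n => meanArrival μ A (t + 1) n + δ) ∈ ratePolytope p) (t : ℕ) :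
    2 * (ENNReal.ofReal δ * ∑ τ ∈ Finset.range t, ∑ n, ∫⁻ ω, ρ (X 0 ω) * X τ ω n ∂μ) ≤
      ∫⁻ ω, ρ (X 0 ω) * ((∑ n, X 0 ω n ^ 2 : ℕ) : ℝ≥0∞) ∂μ +
        t * ENNReal.ofReal (N * Amax ^ 2 + ((M : ℝ) * K) ^ 2) := by
  suffices H : ∫⁻ ω, ρ (X 0 ω) * ((∑ n, X t ω n ^ 2 : ℕ) : ℝ≥0∞) ∂μ +
      2 * (ENNReal.ofReal δ * ∑ τ ∈ Finset.range t, ∑ n, ∫⁻ ω, ρ (X 0 ω) * X τ ω n ∂μ) ≤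
      ∫⁻ ω, ρ (X 0 ω) * ((∑ n, X 0 ω n ^ 2 : ℕ) : ℝ≥0∞) ∂μ +
        t * ENNReal.ofReal (N * Amax ^ 2 + ((M : ℝ) * K) ^ 2) from le_add_self.trans H
  induction t with
  | zero => simp
  | succ t ih =>
    have hd := h.lyapunov_drift hMW hρ hδ t (hP t)
    rw [Finset.sum_range_succ, mul_add, mul_add, add_comm (2 * _) (2 * _), ← add_assoc]
    grw [hd]
    rw [add_right_comm]
    grw [ih]
    push_cast
    exact le_of_eq (by ring)

end IsSystem

/-! ### Truncation of the initial backlog -/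

section Truncation

variable {μ : Measure Ω} {Y : Ω → ℕ}

/-- A second moment truncated at `t` is `o(t)` as soon as the first moment is finite. -/
lemma tendsto_lintegral_truncated_sq (hY : Measurable Y) (hfin : ∫⁻ ω, (Y ω : ℝ≥0∞) ∂μ ≠ ⊤) :
    Tendsto (fun t : ℕ => ∫⁻ ω, (if Y ω ≤ t then (Y ω : ℝ≥0∞) ^ 2 * (t : ℝ≥0∞)⁻¹ else 0) ∂μ)
      atTop (𝓝 0) := by
  rw [show 𝓝 (0 : ℝ≥0∞) = 𝓝 (∫⁻ _, 0 ∂μ) by simp]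
  refine tendsto_lintegral_of_dominated_convergence (fun ω => (Y ω : ℝ≥0∞)) (fun t => ?_)
    (fun t => ae_of_all _ fun ω => ?_) hfin (ae_of_all _ fun ω => ?_)
  · exact (Measurable.of_discrete (f := fun y : ℕ =>
      if y ≤ t then (y : ℝ≥0∞) ^ 2 * (t : ℝ≥0∞)⁻¹ else 0)).comp hY
  · dsimp only
    split_ifs with h
    · rcases Nat.eq_zero_or_pos t with rfl | ht
      · simp [Nat.le_zero.1 h]
      · rw [← div_eq_mul_inv]
        refine ENNReal.div_le_of_le_mul ?_
        rw [sq]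
        gcongr
    · exact zero_le
  · have h0 : Tendsto (fun t : ℕ => (Y ω : ℝ≥0∞) ^ 2 * (t : ℝ≥0∞)⁻¹) atTop (𝓝 0) := by
      simpa using ENNReal.Tendsto.const_mul (a := (Y ω : ℝ≥0∞) ^ 2)
        ENNReal.tendsto_inv_nat_nhds_zero (Or.inr (by finiteness))
    refine tendsto_of_tendsto_of_tendsto_of_le_of_le tendsto_const_nhds h0
      (fun t => zero_le) fun t => ?_
    dsimp only
    split_ifs
    · exact le_rfl
    · exact zero_le

lemma tendsto_lintegral_tail (hY : Measurable Y) (hfin : ∫⁻ ω, (Y ω : ℝ≥0∞) ∂μ ≠ ⊤) :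
    Tendsto (fun t : ℕ => ∫⁻ ω, (if Y ω ≤ t then 0 else (Y ω : ℝ≥0∞)) ∂μ) atTop (𝓝 0) := by
  rw [show 𝓝 (0 : ℝ≥0∞) = 𝓝 (∫⁻ _, 0 ∂μ) by simp]
  refine tendsto_lintegral_of_dominated_convergence (fun ω => (Y ω : ℝ≥0∞)) (fun t => ?_)
    (fun t => ae_of_all _ fun ω => ?_) hfin (ae_of_all _ fun ω => ?_)
  · exact (Measurable.of_discrete (f := fun y : ℕ => if y ≤ t then 0 else (y : ℝ≥0∞))).comp hY
  · dsimp only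
    split_ifs
    · exact zero_le
    · exact le_rfl
  · refine tendsto_const_nhds.congr' ?_
    filter_upwards [eventually_ge_atTop (Y ω)] with t ht
    simp [ht]

end Truncation

namespace IsSystem

variable {μ : Measure Ω} [IsProbabilityMeasure μ] {p : ChannelState N K M → ℝ} {Amax : ℝ}
  {A : ℕ → Ω → Fin N → ℕ} {C : ℕ → Ω → ChannelState N K M}
  {I : ℕ → Ω → Allocation N K} {X : ℕ → Ω → Fin N → ℕ}

/-- The average backlog up to time `t`, by splitting according to whether the initial backlog is at
most `t`: if it is, the accumulated drift applies with a finite initial Lyapunov function; if it is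
not, the backlog grows at most linearly and `t` slots are bounded by the initial backlog itself. -/
lemma timeAverage_backlog_le (h : IsSystem μ p Amax A C I X) (hMW : IsMaxWeight C I X) {δ : ℝ}
    (hδ : 0 < δ) (hP : ∀ t, (fun n => meanArrival μ A (t + 1) n + δ) ∈ ratePolytope p) {t : ℕ}
    (ht : t ≠ 0) :
    (t : ℝ≥0∞)⁻¹ * ∑ τ ∈ Finset.range t, ∑ n, ∫⁻ ω, (X τ ω n : ℝ≥0∞) ∂μ ≤
      (2 * ENNReal.ofReal δ)⁻¹ * ENNReal.ofReal (N * Amax ^ 2 + ((M : ℝ) * K) ^ 2) +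
      ((2 * ENNReal.ofReal δ)⁻¹ * ∫⁻ ω, (if ∑ n, X 0 ω n ≤ t then
          ((∑ n, X 0 ω n : ℕ) : ℝ≥0∞) ^ 2 * (t : ℝ≥0∞)⁻¹ else 0) ∂μ +
        (1 + N * ENNReal.ofReal (Amax ^ 2)) *
          ∫⁻ ω, (if ∑ n, X 0 ω n ≤ t then 0 else ((∑ n, X 0 ω n : ℕ) : ℝ≥0∞)) ∂μ) := by
  set B := ENNReal.ofReal (N * Amax ^ 2 + ((M : ℝ) * K) ^ 2)
  set D := 2 * ENNReal.ofReal δ with hD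
  have hD0 : D ≠ 0 := by simp [hD, hδ]
  have hDtop : D ≠ ⊤ := by finiteness
  have ht0 : (t : ℝ≥0∞) ≠ 0 := by exact_mod_cast ht
  have htt : (t : ℝ≥0∞) ≠ ⊤ := ENNReal.natCast_ne_top t
  set ρ : (Fin N → ℕ) → ℝ≥0∞ := fun x => if ∑ n, x n ≤ t then 1 else 0 with hρdef
  set σ : (Fin N → ℕ) → ℝ≥0∞ := fun x => if ∑ n, x n ≤ t then 0 else 1 with hσdef
  have hρ : ∀ x, ρ x ≤ 1 := fun x => by
    simp only [hρdef]; split_ifs <;> simp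
  have hρσ : ∀ x, ρ x + σ x = 1 := fun x => by
    simp only [hρdef, hσdef]; split_ifs <;> simp
  set T := ∫⁻ ω, (if ∑ n, X 0 ω n ≤ t then 0 else ((∑ n, X 0 ω n : ℕ) : ℝ≥0∞)) ∂μ with hT
  set Q := ∫⁻ ω, (if ∑ n, X 0 ω n ≤ t then
    ((∑ n, X 0 ω n : ℕ) : ℝ≥0∞) ^ 2 * (t : ℝ≥0∞)⁻¹ else 0) ∂μ with hQ
  have hsplit : ∀ τ n, ∫⁻ ω, (X τ ω n : ℝ≥0∞) ∂μ =
      ∫⁻ ω, ρ (X 0 ω) * X τ ω n ∂μ + ∫⁻ ω, σ (X 0 ω) * X τ ω n ∂μ := fun τ n => by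
    rw [← lintegral_add_left (h.measurable_queue_comp τ fun x y => ρ x * y n)]
    exact lintegral_congr fun ω => by rw [← add_mul, hρσ, one_mul]
  have hsmall : ∑ τ ∈ Finset.range t, ∑ n, ∫⁻ ω, ρ (X 0 ω) * X τ ω n ∂μ ≤
      D⁻¹ * (t * Q + t * B) := by
    have h1 := h.sum_backlog_le hMW hρ hδ.le hP t
    rw [← mul_assoc, ← hD] at h1
    have h2 : ∫⁻ ω, ρ (X 0 ω) * ((∑ n, X 0 ω n ^ 2 : ℕ) : ℝ≥0∞) ∂μ ≤ t * Q := by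
      rw [hQ, ← lintegral_const_mul' _ _ htt]
      refine lintegral_mono fun ω => ?_
      simp only [hρdef]
      split_ifs
      · rw [one_mul, mul_left_comm, ENNReal.mul_inv_cancel ht0 htt, mul_one]
        have : ∑ n, X 0 ω n ^ 2 ≤ (∑ n, X 0 ω n) ^ 2 :=
          Finset.sum_sq_le_sq_sum_of_nonneg fun n _ => Nat.zero_le _
        exact_mod_cast this
      · simp
    grw [h2] at h1
    rw [mul_comm, ← div_eq_mul_inv, ENNReal.le_div_iff_mul_le (Or.inl hD0) (Or.inl hDtop),
      mul_comm]
    exact h1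
  have hσ : t * ∫⁻ ω, σ (X 0 ω) ∂μ ≤ T := by
    rw [hT, ← lintegral_const_mul' _ _ htt]
    refine lintegral_mono fun ω => ?_
    simp only [hσdef]
    split_ifs with hle
    · simp
    · rw [mul_one]
      exact_mod_cast (not_le.1 hle).le
  have hσX : ∑ n, ∫⁻ ω, σ (X 0 ω) * X 0 ω n ∂μ = T := by
    rw [hT, ← lintegral_finsetSum _ fun n _ => h.measurable_queue_comp 0 fun x y => σ x * y n]
    refine lintegral_congr fun ω => ?_
    rw [← Finset.mul_sum]
    simp only [hσdef]
    split_ifs <;> simp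
  have hlarge : ∑ τ ∈ Finset.range t, ∑ n, ∫⁻ ω, σ (X 0 ω) * X τ ω n ∂μ ≤
      t * ((1 + N * ENNReal.ofReal (Amax ^ 2)) * T) := by
    have : ∀ τ ∈ Finset.range t, ∑ n, ∫⁻ ω, σ (X 0 ω) * X τ ω n ∂μ ≤
        (1 + N * ENNReal.ofReal (Amax ^ 2)) * T := fun τ hτ => by
      have hτt : (τ : ℝ≥0∞) ≤ t := by exact_mod_cast (Finset.mem_range.1 hτ).le
      calc ∑ n, ∫⁻ ω, σ (X 0 ω) * X τ ω n ∂μ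
          ≤ ∑ n, (∫⁻ ω, σ (X 0 ω) * X 0 ω n ∂μ +
              τ * (ENNReal.ofReal (Amax ^ 2) * ∫⁻ ω, σ (X 0 ω) ∂μ)) :=
            Finset.sum_le_sum fun n _ => h.lintegral_queue_le σ n τ
        _ = T + N * ENNReal.ofReal (Amax ^ 2) * (τ * ∫⁻ ω, σ (X 0 ω) ∂μ) := by
            rw [Finset.sum_add_distrib, hσX, Finset.sum_const, Finset.card_univ, Fintype.card_fin,
              nsmul_eq_mul]
            ring
        _ ≤ T + N * ENNReal.ofReal (Amax ^ 2) * T := by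
            gcongr
            exact (mul_le_mul_left hτt _).trans hσ
        _ = _ := by ring
    refine (Finset.sum_le_sum this).trans_eq ?_
    rw [Finset.sum_const, Finset.card_range, nsmul_eq_mul]
  simp_rw [hsplit, Finset.sum_add_distrib]
  grw [hsmall, hlarge]
  refine le_of_eq ?_
  calc (t : ℝ≥0∞)⁻¹ * (D⁻¹ * (t * Q + t * B) + t * ((1 + N * ENNReal.ofReal (Amax ^ 2)) * T))
      = ((t : ℝ≥0∞)⁻¹ * t) * (D⁻¹ * B + (D⁻¹ * Q + (1 + N * ENNReal.ofReal (Amax ^ 2)) * T)) := by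
        ring
    _ = _ := by rw [ENNReal.inv_mul_cancel ht0 htt, one_mul]

/-- Both error terms of `timeAverage_backlog_le` vanish in the limit. -/
theorem averageBacklog_le (h : IsSystem μ p Amax A C I X) (hMW : IsMaxWeight C I X) {δ : ℝ}
    (hδ : 0 < δ) (hP : ∀ t, (fun n => meanArrival μ A (t + 1) n + δ) ∈ ratePolytope p) :
    averageBacklog μ X ≤
      ENNReal.ofReal ((N * Amax ^ 2 + ((M : ℝ) * K) ^ 2) / (2 * δ)) := by
  have hY : Measurable fun ω => ∑ n, X 0 ω n :=
    (Measurable.of_discrete (f := fun x : Fin N → ℕ => ∑ n, x n)).comp (h.measurable_queue 0)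
  have hfin : ∫⁻ ω, ((∑ n, X 0 ω n : ℕ) : ℝ≥0∞) ∂μ ≠ ⊤ := by
    push_cast
    rw [lintegral_finsetSum _ fun n _ => h.measurable_queue_comp 0 fun _ y => (y n : ℝ≥0∞)]
    exact ENNReal.sum_ne_top.2 fun n _ => (h.initial n).ne
  have hlim := ((ENNReal.Tendsto.const_mul (a := (2 * ENNReal.ofReal δ)⁻¹)
    (tendsto_lintegral_truncated_sq hY hfin) (Or.inr (by simp [hδ]))).add
    (ENNReal.Tendsto.const_mul (a := 1 + N * ENNReal.ofReal (Amax ^ 2))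
    (tendsto_lintegral_tail hY hfin) (Or.inr (by finiteness)))).const_add
    ((2 * ENNReal.ofReal δ)⁻¹ * ENNReal.ofReal (N * Amax ^ 2 + ((M : ℝ) * K) ^ 2))
  refine (limsup_le_limsup ((eventually_ne_atTop 0).mono fun t ht =>
    h.timeAverage_backlog_le hMW hδ hP ht)).trans ?_
  rw [hlim.limsup_eq, mul_zero, mul_zero, add_zero, add_zero,
    ENNReal.ofReal_div_of_pos (by positivity), ENNReal.ofReal_mul zero_le_two, div_eq_mul_inv,
    mul_comm]
  simp

end IsSystem

lemma stronglyStable_of_averageBacklog_lt_top {μ : Measure Ω} {X : ℕ → Ω → Fin N → ℕ}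
    (h : averageBacklog μ X < ⊤) : StronglyStable μ X := fun n => by
  refine lt_of_le_of_lt (limsup_le_limsup (Eventually.of_forall fun t => ?_)) h
  dsimp only
  gcongr
  exact Finset.single_le_sum (f := fun n => ∫⁻ ω, (X _ ω n : ℝ≥0∞) ∂μ) (fun _ _ => zero_le)
    (Finset.mem_univ n)

end MQMS

theorem theorem2 {Ω : Type*} [MeasurableSpace Ω] (μ : Measure Ω) [IsProbabilityMeasure μ]
    {N K M : ℕ} (hN : 1 ≤ N)
    (p : MQMS.ChannelState N K M → ℝ) (Amax : ℝ)
    (A : ℕ → Ω → Fin N → ℕ) (C : ℕ → Ω → MQMS.ChannelState N K M)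
    (I : ℕ → Ω → MQMS.Allocation N K) (X : ℕ → Ω → Fin N → ℕ)
    (hsys : MQMS.IsSystem μ p Amax A C I X)
    (hMW : MQMS.IsMaxWeight C I X)
    (VHat : Set (Fin N → ℝ)) (hVHat : MQMS.IsVHat N M VHat)
    (hstrict : ∀ α ∈ VHat, ∃ ε : ℝ, 0 < ε ∧ ∀ t : ℕ,
      ∑ n, α n * MQMS.meanArrival μ A (t + 1) n + ε ≤ MQMS.maxMeanWeight p α) :
    MQMS.StronglyStable μ X ∧
    ∃ δ : ℝ,
      IsGreatest {d : ℝ | 0 < d ∧ ∀ t : ℕ,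
        (fun n => MQMS.meanArrival μ A (t + 1) n + d) ∈ MQMS.ratePolytope p} δ ∧
      MQMS.averageBacklog μ X ≤
        ENNReal.ofReal ((N * Amax ^ 2 + ((M : ℝ) * K) ^ 2) / (2 * δ)) := by
  have : Nonempty (Fin N) := ⟨⟨0, hN⟩⟩
  obtain ⟨δ, hδ⟩ := MQMS.exists_isGreatest_slack
    (MQMS.exists_pos_forall_add_mem_ratePolytope hsys.p_nonneg hVHat
      (fun t n => integral_nonneg fun ω => Nat.cast_nonneg (A (t + 1) ω n)) hstrict)
  have hle := hsys.averageBacklog_le hMW hδ.1.1 hδ.1.2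
  exact ⟨MQMS.stronglyStable_of_averageBacklog_lt_top (hle.trans_lt ENNReal.ofReal_lt_top),
    δ, hδ, hle⟩
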